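/- Throughout, $V$ is a transitive model of ZFC (a set or a class), $\mathbb P\in V$ is a forcing notion (a nonempty preordered set), $G\subseteq\mathbb P$ is a $V$-generic filter and $V[G]$ is the generic extension. For $N\in\{V,V[G]\}$, a class of $N$ is one definable over $(N,\in)$ with parameters from $N$; an embedding $j:N\to M$ of $N$ is always a fully elementary embedding into a transitive class $M\subseteq N$, with $M$ and $j$ classes of $N$; its critical point $\mathrm{crit}(j)$ is the least ordinal moved by $j$; and $V_\alpha^{N}$ is the set of elements of $N$ of rank less than $\alpha$. - A cardinal $\delta$ of $N$ is Woodin in $N$ if for every function $f:\delta\to\delta$ in $N$ there are $\kappa<\delta$ with $f``\kappa\subseteq\kappa$ and an embedding $j:N\to M$ of $N$ with $\mathrm{crit}(j)=\kappa$ and $V^{N}_{j(f)(\kappa)}\subseteq M$. - For ordinals $\kappa\le\lambda$ and a set $A\in N$, an embedding $j:N\to M$ of $N$ with $\mathrm{crit}(j)=\kappa$ is a $\lambda$-strongness for $A$ embedding if $j(\kappa)>\lambda$, $V^{N}_\lambda\subseteq M$ and $A\cap V^{N}_\lambda=j(A)\cap V^{N}_\lambda$. - $\mathbb P$ is ${}^\delta\delta$-bounding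 (over $V$) if in every generic extension of $V$ by $\mathbb P$, for every function $f:\delta\to\delta$ there is a function $g:\delta\to\delta$ in $V$ with $f(\alpha)<g(\alpha)$ for all $\alpha<\delta$. **Proposition.** Suppose $\delta$ is Woodin in $V$, $\mathbb P$ is ${}^\delta\delta$-bounding and $G\subseteq\mathbb P$ is a $V$-generic filter. Suppose that for every function $f:\delta\to\delta$ with $f\in V$ there are $\kappa\le\lambda<\delta$ such that $f``\lambda\subseteq\lambda$, $\lambda>f(\kappa)$, and there is (in the universe $V[G]$) a $\lambda$-strongness for $f$ embedding $j:V[G]\to M$ with $\mathrm{crit}(j)=\kappa$. Then $\delta$ is Woodin in $V[G]$. -/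

import Mathlib

open FirstOrder

universe u

namespace WoodinForcing

/-! ### The language of set theory and transitive models of ZFC

A *universe* is a transitive class `N : Set ZFSet`, viewed as a first-order structure for the
language with one binary relation symbol `∈`.  A *class of `N`* is a subset of `N` (or of `N × N`)
which is first-order definable over `(N, ∈)` with parameters from `N`. -/

/-- The relation symbols of the language of set theory: one binary symbol. -/
inductive MemSymbol : ℕ → Type
  | mem : MemSymbol 2

/-- The first-order language of set theory. -/
def setLang : FirstOrder.Language.{0, 0} := ⟨fun _ => Empty, MemSymbol⟩

/-- Every class of sets is a structure for the language of set theory, with the true membership. -/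
instance memStructure (N : Set ZFSet.{u}) : setLang.Structure N where
  funMap := fun f => nomatch f
  RelMap := fun {_} r =>
    match r with
    | .mem => fun v => (v 0 : ZFSet.{u}) ∈ (v 1 : ZFSet.{u})

/-- `N` is a transitive class. -/
def TransClass (N : Set ZFSet.{u}) : Prop :=
  ∀ x ∈ N, ∀ y ∈ x, y ∈ N

/-- `V` is a transitive class (possibly a set) such that `(V, ∈)` satisfies all axioms of ZFC;
each axiom is written with all its quantifiers relativized to `V`. -/
structure IsTransitiveModelZFC (V : Set ZFSet.{u}) : Prop where
  trans : TransClass V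
  extensionality : ∀ x y : V, (∀ z : V, z.1 ∈ x.1 ↔ z.1 ∈ y.1) → x = y
  foundation : ∀ x : V, (∃ y : V, y.1 ∈ x.1) →
    ∃ y : V, y.1 ∈ x.1 ∧ ∀ z : V, ¬ (z.1 ∈ x.1 ∧ z.1 ∈ y.1)
  pairing : ∀ x y : V, ∃ z : V, ∀ w : V, w.1 ∈ z.1 ↔ w = x ∨ w = y
  union : ∀ x : V, ∃ y : V, ∀ w : V, w.1 ∈ y.1 ↔ ∃ z : V, w.1 ∈ z.1 ∧ z.1 ∈ x.1
  powerset : ∀ x : V, ∃ y : V, ∀ w : V, w.1 ∈ y.1 ↔ ∀ z : V, z.1 ∈ w.1 → z.1 ∈ x.1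
  infinity : ∃ x : V, (∃ e : V, e.1 ∈ x.1 ∧ ∀ z : V, z.1 ∉ e.1) ∧
    ∀ y : V, y.1 ∈ x.1 → ∃ s : V, s.1 ∈ x.1 ∧ ∀ z : V, z.1 ∈ s.1 ↔ z.1 ∈ y.1 ∨ z = y
  separation : ∀ D : Set V, Set.univ.Definable₁ setLang D →
    ∀ a : V, ∃ b : V, ∀ x : V, x.1 ∈ b.1 ↔ x.1 ∈ a.1 ∧ x ∈ D
  replacement : ∀ R : Set (V × V), Set.univ.Definable₂ setLang R →
    (∀ x y y' : V, (x, y) ∈ R → (x, y') ∈ R → y = y') →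
    ∀ a : V, ∃ b : V, ∀ y : V, y.1 ∈ b.1 ↔ ∃ x : V, x.1 ∈ a.1 ∧ (x, y) ∈ R
  choice : ∀ x : V, (∀ y : V, y.1 ∈ x.1 → ∃ z : V, z.1 ∈ y.1) →
    (∀ y y' z : V, y.1 ∈ x.1 → y'.1 ∈ x.1 → z.1 ∈ y.1 → z.1 ∈ y'.1 → y = y') →
    ∃ c : V, ∀ y : V, y.1 ∈ x.1 → ∃! z : V, z.1 ∈ c.1 ∧ z.1 ∈ y.1

/-- `(V_α)^N`: the sets of rank less than `α` which belong to the transitive class `N`. -/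
def rankInitial (N : Set ZFSet.{u}) (α : Ordinal.{u}) : Set ZFSet.{u} :=
  {x | x ∈ N ∧ x ∈ ZFSet.vonNeumann α}

/-- `α` is a closure point of the (set) function `f`: `f '' α ⊆ α`. -/
def IsClosurePoint (f : ZFSet.{u}) (α : Ordinal.{u}) : Prop :=
  ∀ x ∈ α.toZFSet, ∀ y, ZFSet.pair x y ∈ f → y ∈ α.toZFSet

/-- `N ⊨ "δ is a cardinal"`: `δ` is an ordinal of `N` and no bijection in `N` maps a smaller
ordinal onto `δ`. -/
def IsCardinalIn (N : Set ZFSet.{u}) (δ : Ordinal.{u}) : Prop :=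
  δ.toZFSet ∈ N ∧ ∀ α < δ, ∀ b ∈ N, ZFSet.IsFunc α.toZFSet δ.toZFSet b →
    ¬ ∀ y ∈ δ.toZFSet, ∃! x, ZFSet.pair x y ∈ b

/-! ### Elementary embeddings, Woodin cardinals, strongness -/

/-- An elementary embedding `j : N → M` in the sense of the universe `N`: `M ⊆ N` is a
transitive class, `j` is elementary for all first-order formulas of set theory, and both `M` and
(the graph of) `j` are classes of `N`. -/
structure ClassEmbedding (N : Set ZFSet.{u}) where
  /-- the target model -/
  M : Set ZFSet.{u}
  subset : M ⊆ N
  trans : TransClass M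
  /-- the embedding -/
  j : N ↪ₑ[setLang] M
  definable_target : Set.univ.Definable₁ setLang {x : N | x.1 ∈ M}
  definable_graph : Set.univ.Definable₂ setLang {p : N × N | (j p.1).1 = p.2.1}

namespace ClassEmbedding

variable {N : Set ZFSet.{u}}

/-- `e.Maps x y` says that `x ∈ N` and `j(x) = y`. -/
def Maps (e : ClassEmbedding N) (x y : ZFSet.{u}) : Prop :=
  ∃ hx : x ∈ N, (e.j ⟨x, hx⟩).1 = y

/-- `crit(j) = κ`: `κ` is the least ordinal moved by `j`. -/
def Crit (e : ClassEmbedding N) (κ : Ordinal.{u}) : Prop :=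
  (∀ α < κ, e.Maps α.toZFSet α.toZFSet) ∧ ∃ y, e.Maps κ.toZFSet y ∧ y ≠ κ.toZFSet

/-- `j` is a `lam`-strongness embedding with critical point `κ` (in the universe `N`):
`crit(j) = κ`, `j(κ) > lam` and `V_lam ⊆ M`.  By convention `lam ≥ κ`. -/
def IsStrongness (e : ClassEmbedding N) (κ lam : Ordinal.{u}) : Prop :=
  κ ≤ lam ∧ e.Crit κ ∧ (∃ y, e.Maps κ.toZFSet y ∧ lam.toZFSet ∈ y) ∧ rankInitial N lam ⊆ e.M

/-- `j` is a `lam`-strongness for `A` embedding with critical point `κ`: a `lam`-strongness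
embedding with `A ∩ V_lam = j(A) ∩ V_lam`. -/
def IsStrongnessFor (e : ClassEmbedding N) (A : ZFSet.{u}) (κ lam : Ordinal.{u}) : Prop :=
  e.IsStrongness κ lam ∧
    ∃ B, e.Maps A B ∧ ∀ x ∈ rankInitial N lam, x ∈ A ↔ x ∈ B

end ClassEmbedding

/-- `N ⊨ "δ is a Woodin cardinal"`: for every `f : δ → δ` in `N` there are a closure point `κ < δ`
of `f` and an elementary embedding `j : N → M` with critical point `κ` and
`(V_{j(f)(κ)})^N ⊆ M`. -/
def IsWoodinIn (N : Set ZFSet.{u}) (δ : Ordinal.{u}) : Prop :=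
  IsCardinalIn N δ ∧
    ∀ f ∈ N, ZFSet.IsFunc δ.toZFSet δ.toZFSet f →
      ∃ κ < δ, IsClosurePoint f κ ∧ ∃ e : ClassEmbedding N, e.Crit κ ∧
        ∃ (F : ZFSet.{u}) (β : Ordinal.{u}), e.Maps f F ∧
          ZFSet.pair κ.toZFSet β.toZFSet ∈ F ∧ rankInitial N β ⊆ e.M

/-! ### Forcing -/

/-- A forcing notion: a nonempty preordered set.  Smaller conditions are stronger. -/
structure ForcingNotion where
  /-- the set of conditions -/
  P : ZFSet.{u}
  /-- the order, as a set of ordered pairs -/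
  le : ZFSet.{u}
  nonempty : ∃ p, p ∈ P
  le_subset : le ⊆ ZFSet.prod P P
  refl : ∀ p ∈ P, ZFSet.pair p p ∈ le
  trans : ∀ p q r, ZFSet.pair p q ∈ le → ZFSet.pair q r ∈ le → ZFSet.pair p r ∈ le

/-- The forcing notion is an element of `V`. -/
def ForcingNotion.Mem (ℙ : ForcingNotion.{u}) (V : Set ZFSet.{u}) : Prop :=
  ℙ.P ∈ V ∧ ℙ.le ∈ V

/-- `D` is a dense subset of the forcing notion. -/
def ForcingNotion.IsDense (ℙ : ForcingNotion.{u}) (D : ZFSet.{u}) : Prop :=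
  D ⊆ ℙ.P ∧ ∀ p ∈ ℙ.P, ∃ q ∈ D, ZFSet.pair q p ∈ ℙ.le

/-- `G` is a `V`-generic filter on the forcing notion. -/
structure IsGenericFilter (V : Set ZFSet.{u}) (ℙ : ForcingNotion.{u}) (G : ZFSet.{u}) : Prop where
  subset : G ⊆ ℙ.P
  nonempty : ∃ p, p ∈ G
  upward : ∀ p ∈ G, ∀ q, ZFSet.pair p q ∈ ℙ.le → q ∈ G
  directed : ∀ p ∈ G, ∀ q ∈ G, ∃ r ∈ G, ZFSet.pair r p ∈ ℙ.le ∧ ZFSet.pair r q ∈ ℙ.le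
  generic : ∀ D ∈ V, ℙ.IsDense D → ∃ p ∈ G, p ∈ D

/-- `τ` is a `P`-name: all elements of `τ` are pairs `(σ, p)` with `p ∈ P` and `σ` a `P`-name. -/
inductive IsName (P : ZFSet.{u}) : ZFSet.{u} → Prop
  | mk (τ : ZFSet.{u}) (hpair : ∀ z ∈ τ, ∃ σ, ∃ p ∈ P, z = ZFSet.pair σ p)
      (hname : ∀ σ p, ZFSet.pair σ p ∈ τ → IsName P σ) : IsName P τ

theorem rank_lt_of_mem_sUnion_sUnion {σ τ : ZFSet.{u}} (h : σ ∈ ZFSet.sUnion (ZFSet.sUnion τ)) :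
    σ.rank < τ.rank := by
  obtain ⟨a, ha, hσ⟩ := ZFSet.mem_sUnion.1 h
  obtain ⟨b, hb, hab⟩ := ZFSet.mem_sUnion.1 ha
  exact (ZFSet.rank_lt_of_mem hσ).trans ((ZFSet.rank_lt_of_mem hab).trans (ZFSet.rank_lt_of_mem hb))

/-- The interpretation of names by `G`, `τ_G = {σ_G | ∃ p ∈ G, (σ, p) ∈ τ}`.  (The set
`⋃₀ ⋃₀ τ` only serves as a set which contains every `σ` with some `(σ, p) ∈ τ`.) -/
noncomputable def val (G : ZFSet.{u}) (τ : ZFSet.{u}) : ZFSet.{u} :=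
  ZFSet.range fun σ : ↥(ZFSet.sep (fun σ => ∃ p ∈ G, ZFSet.pair σ p ∈ τ)
    (ZFSet.sUnion (ZFSet.sUnion τ))) => val G σ.1
termination_by τ.rank
decreasing_by exact rank_lt_of_mem_sUnion_sUnion (ZFSet.mem_sep.1 σ.2).1

theorem mem_val {G τ x : ZFSet.{u}} :
    x ∈ val G τ ↔ ∃ σ, ∃ p ∈ G, ZFSet.pair σ p ∈ τ ∧ x = val G σ := by
  rw [val, ZFSet.mem_range]
  constructor
  · rintro ⟨⟨σ, hσ⟩, rfl⟩
    obtain ⟨-, p, hp, hm⟩ := ZFSet.mem_sep.1 hσ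
    exact ⟨σ, p, hp, hm, rfl⟩
  · rintro ⟨σ, p, hp, hm, rfl⟩
    refine ⟨⟨σ, ZFSet.mem_sep.2 ⟨?_, p, hp, hm⟩⟩, rfl⟩
    refine ZFSet.mem_sUnion.2 ⟨{σ}, ZFSet.mem_sUnion.2 ⟨_, hm, ?_⟩, ZFSet.mem_singleton.2 rfl⟩
    simp [ZFSet.pair]

/-- The generic extension `V[G]`: the interpretations by `G` of all names in `V`. -/
def genericExt (V : Set ZFSet.{u}) (ℙ : ForcingNotion.{u}) (G : ZFSet.{u}) : Set ZFSet.{u} :=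
  {x | ∃ τ ∈ V, IsName ℙ.P τ ∧ x = val G τ}

/-- `ℙ` is `^δ δ`-bounding over `V`: it is forced, i.e. true in every generic extension `V[G]` of
`V` by `ℙ`, that every `f : δ → δ` is strictly bounded everywhere by some `g : δ → δ` in `V`. -/
def IsBounding (V : Set ZFSet.{u}) (ℙ : ForcingNotion.{u}) (δ : Ordinal.{u}) : Prop :=
  ∀ G, IsGenericFilter V ℙ G →
    ∀ f ∈ genericExt V ℙ G, ZFSet.IsFunc δ.toZFSet δ.toZFSet f →
      ∃ g ∈ V, ZFSet.IsFunc δ.toZFSet δ.toZFSet g ∧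
        ∀ α β γ : ZFSet.{u}, ZFSet.pair α β ∈ f → ZFSet.pair α γ ∈ g → β ∈ γ

end WoodinForcing

/-!
Write `N = V[G]` and let `f : δ → δ` be in `N`.  By the bounding hypothesis some `g : δ → δ` in `V`
lies strictly above `f`, and `g` lies below `h(ξ) = max(g(ξ), ξ + 1)`, again a function of `V`.  The
hypothesis on functions of `V` gives `κ ≤ lam < δ` and `j : N → M` for `h`.  Since `h` is
progressive and maps `lam` to itself, `lam` is a limit, so that the pairs `(a, h(a))` with
`a, h(a) < lam` lie in `V_lam`, where `h` and `j(h)` agree.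

* For `a < κ` this gives `j(h(a)) = j(h)(a) = h(a)`, so `h(a)`, being below `lam < j(κ)`, is below
  `κ`: the critical point is closed under `h`, hence under `f`
  (`ClassEmbedding.IsStrongnessFor.isClosurePoint`).
* For `a = κ` it gives `j(f)(κ) < j(h)(κ) = h(κ) < lam` by elementarity, so `V_lam ⊆ M` contains
  `V_{j(f)(κ)}`.

That `δ` remains a cardinal uses the same embeddings.  Given `α < δ`, take `g` constant with value
`α`; then `α < κ`, as `κ` is closed under `h ≥ g`.  If `b : α → δ` were a surjection in `N`, then
`j(b) : α → j(δ)` would be a surjection all of whose values lie in the range of `j`, which omits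
`κ ∈ j(δ)`.

Two background facts are needed.  First-order definability over `(N, ∈)` is handled through
`UnifDef`, predicates defined by one formula over all classes at once: `UnifDef.elementary` transfers
them along embeddings and `UnifDef.definable₂` feeds them to replacement in `V`, which builds `h`.
And `δ ∈ V[G]` requires the check name of `δ` to be in `V`; the recursion for check names is carried
out inside `V` in `IsTransitiveModelZFC.check_mem`.
-/

namespace WoodinForcing

/-! ### Uniformly definable predicates -/

/-- A predicate on `n`-tuples, given simultaneously over every class `N` of sets, is uniformly
definable if one parameter-free formula of set theory defines it over every `(N, ∈)`.  Such
predicates are preserved by elementary embeddings, and fixing some of their arguments gives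
relations definable with parameters. -/
def UnifDef (n : ℕ) (P : ∀ N : Set ZFSet.{u}, (Fin n → N) → Prop) : Prop :=
  ∃ φ : setLang.BoundedFormula Empty n, ∀ (N : Set ZFSet.{u}) (v : Fin n → N),
    φ.Realize default v ↔ P N v

namespace UnifDef

variable {n : ℕ} {P Q : ∀ N : Set ZFSet.{u}, (Fin n → N) → Prop}

theorem mem (i j : Fin n) : UnifDef.{u} n fun _ v => (v i).1 ∈ (v j).1 := by
  let r : setLang.Relations 2 := MemSymbol.mem
  exact ⟨r.boundedFormula₂ (FirstOrder.Language.Term.var (Sum.inr i))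
    (FirstOrder.Language.Term.var (Sum.inr j)),
    fun _ _ => FirstOrder.Language.BoundedFormula.realize_rel₂⟩

theorem eq (i j : Fin n) : UnifDef.{u} n fun _ v => v i = v j :=
  ⟨FirstOrder.Language.Term.bdEqual
    (FirstOrder.Language.Term.var (Sum.inr i)) (FirstOrder.Language.Term.var (Sum.inr j)),
    fun _ _ => FirstOrder.Language.BoundedFormula.realize_bdEqual _ _⟩

theorem not (hP : UnifDef n P) : UnifDef n fun N v => ¬ P N v := by
  obtain ⟨φ, hφ⟩ := hP
  exact ⟨φ.not, fun N v => by rw [FirstOrder.Language.BoundedFormula.realize_not, hφ]⟩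

theorem imp (hP : UnifDef n P) (hQ : UnifDef n Q) : UnifDef n fun N v => P N v → Q N v := by
  obtain ⟨φ, hφ⟩ := hP
  obtain ⟨ψ, hψ⟩ := hQ
  exact ⟨φ.imp ψ, fun N v => by rw [FirstOrder.Language.BoundedFormula.realize_imp, hφ, hψ]⟩

theorem and (hP : UnifDef n P) (hQ : UnifDef n Q) : UnifDef n fun N v => P N v ∧ Q N v := by
  obtain ⟨φ, hφ⟩ := hP
  obtain ⟨ψ, hψ⟩ := hQ
  exact ⟨φ ⊓ ψ, fun N v => by rw [FirstOrder.Language.BoundedFormula.realize_inf, hφ, hψ]⟩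

theorem or (hP : UnifDef n P) (hQ : UnifDef n Q) : UnifDef n fun N v => P N v ∨ Q N v := by
  obtain ⟨φ, hφ⟩ := hP
  obtain ⟨ψ, hψ⟩ := hQ
  exact ⟨φ ⊔ ψ, fun N v => by rw [FirstOrder.Language.BoundedFormula.realize_sup, hφ, hψ]⟩

theorem iff (hP : UnifDef n P) (hQ : UnifDef n Q) : UnifDef n fun N v => (P N v ↔ Q N v) := by
  obtain ⟨φ, hφ⟩ := hP
  obtain ⟨ψ, hψ⟩ := hQ
  exact ⟨φ.iff ψ, fun N v => by rw [FirstOrder.Language.BoundedFormula.realize_iff, hφ, hψ]⟩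

theorem ex {P : ∀ N : Set ZFSet.{u}, (Fin n → N) → N → Prop}
    (hP : UnifDef (n + 1) fun N v => P N (fun i => v i.castSucc) (v (Fin.last n))) :
    UnifDef n fun N v => ∃ x : N, P N v x := by
  obtain ⟨φ, hφ⟩ := hP
  refine ⟨φ.ex, fun N v => ?_⟩
  simp [FirstOrder.Language.BoundedFormula.realize_ex, hφ]

theorem all {P : ∀ N : Set ZFSet.{u}, (Fin n → N) → N → Prop}
    (hP : UnifDef (n + 1) fun N v => P N (fun i => v i.castSucc) (v (Fin.last n))) :
    UnifDef n fun N v => ∀ x : N, P N v x := by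
  obtain ⟨φ, hφ⟩ := hP
  refine ⟨φ.all, fun N v => ?_⟩
  simp [FirstOrder.Language.BoundedFormula.realize_all, hφ]

theorem elementary (hP : UnifDef n P) {N M : Set ZFSet.{u}} (j : N ↪ₑ[setLang] M) (v : Fin n → N) :
    P M (fun i => j (v i)) ↔ P N v := by
  obtain ⟨φ, hφ⟩ := hP
  rw [← hφ, ← hφ, ← j.map_boundedFormula φ default v]
  exact iff_of_eq (congrArg₂ _ (Subsingleton.elim _ _) rfl)

theorem definable₂ {P : ∀ N : Set ZFSet.{u}, (Fin (n + 2) → N) → Prop} (hP : UnifDef (n + 2) P)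
    {N : Set ZFSet.{u}} (c : Fin n → N) :
    Set.univ.Definable₂ setLang
      {p : N × N | P N (Matrix.vecCons p.1 (Matrix.vecCons p.2 c))} := by
  obtain ⟨φ, hφ⟩ := hP
  refine Set.definable_iff_exists_formula_sum.2 ⟨φ.toFormula.relabel
    (Sum.elim Empty.elim (Matrix.vecCons (Sum.inr 0) (Matrix.vecCons (Sum.inr 1)
      fun i => Sum.inl ⟨c i, trivial⟩))), ?_⟩
  ext v
  simp only [Set.mem_ofPred_eq, FirstOrder.Language.Formula.realize_relabel,
    FirstOrder.Language.BoundedFormula.realize_toFormula]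
  rw [← hφ]
  refine iff_of_eq (congrArg₂ _ (Subsingleton.elim _ _) ?_)
  funext i
  refine Fin.cases rfl (fun i => Fin.cases rfl (fun i => rfl) i) i

end UnifDef

/-! ### Ordered pairs in a transitive class -/

/-- `N ⊨ "z is the ordered pair of x and y"`. -/
def PairIn (N : Set ZFSet.{u}) (x y z : N) : Prop :=
  ∃ a b : N, (∀ w : N, w.1 ∈ a.1 ↔ w = x) ∧ (∀ w : N, w.1 ∈ b.1 ↔ w = x ∨ w = y) ∧
    ∀ w : N, w.1 ∈ z.1 ↔ w = a ∨ w = b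

theorem UnifDef.pairIn {n : ℕ} (i j k : Fin n) :
    UnifDef.{u} n fun N v => PairIn N (v i) (v j) (v k) :=
  .ex <| .ex <| .and (.all <| .iff (.mem _ _) (.eq _ _)) <|
    .and (.all <| .iff (.mem _ _) (.or (.eq _ _) (.eq _ _)))
      (.all <| .iff (.mem _ _) (.or (.eq _ _) (.eq _ _)))

/-- `N ⊨ "(x, y) ∈ f"`. -/
def PairMemIn (N : Set ZFSet.{u}) (x y f : N) : Prop :=
  ∃ z : N, PairIn N x y z ∧ z.1 ∈ f.1

theorem UnifDef.pairMemIn {n : ℕ} (i j k : Fin n) :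
    UnifDef.{u} n fun N v => PairMemIn N (v i) (v j) (v k) :=
  .ex <| .and (.pairIn _ _ _) (.mem _ _)

namespace TransClass

variable {N : Set ZFSet.{u}}

theorem mem (hN : TransClass N) {x y : ZFSet.{u}} (hy : y ∈ N) (h : x ∈ y) : x ∈ N :=
  hN y hy x h

theorem of_pair_mem (hN : TransClass N) {x y : ZFSet.{u}} (h : ZFSet.pair x y ∈ N) :
    x ∈ N ∧ y ∈ N := by
  have h2 : ({x, y} : ZFSet.{u}) ∈ N := hN.mem h (by simp [ZFSet.pair])
  exact ⟨hN.mem h2 (by simp), hN.mem h2 (by simp)⟩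

theorem of_pair_mem_mem (hN : TransClass N) {x y f : ZFSet.{u}} (hf : f ∈ N)
    (h : ZFSet.pair x y ∈ f) : x ∈ N ∧ y ∈ N :=
  hN.of_pair_mem (hN.mem hf h)

theorem pairIn_iff (hN : TransClass N) {x y z : N} :
    PairIn N x y z ↔ z.1 = ZFSet.pair x.1 y.1 := by
  constructor
  · rintro ⟨a, b, ha, hb, hz⟩
    have ha' : a.1 = {x.1} := by
      ext w
      rw [ZFSet.mem_singleton]
      refine ⟨fun h => ?_, fun h => ?_⟩
      · exact congrArg Subtype.val ((ha ⟨w, hN.mem a.2 h⟩).1 h)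
      · exact h ▸ (ha x).2 rfl
    have hb' : b.1 = {x.1, y.1} := by
      ext w
      rw [ZFSet.mem_pair]
      refine ⟨fun h => ?_, ?_⟩
      · exact ((hb ⟨w, hN.mem b.2 h⟩).1 h).imp (congrArg Subtype.val) (congrArg Subtype.val)
      · rintro (rfl | rfl)
        · exact (hb x).2 (.inl rfl)
        · exact (hb y).2 (.inr rfl)
    ext w
    rw [ZFSet.pair, ZFSet.mem_pair, ← ha', ← hb']
    refine ⟨fun h => ?_, ?_⟩
    · exact ((hz ⟨w, hN.mem z.2 h⟩).1 h).imp (congrArg Subtype.val) (congrArg Subtype.val)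
    · rintro (rfl | rfl)
      · exact (hz a).2 (.inl rfl)
      · exact (hz b).2 (.inr rfl)
  · intro h
    have hz := z.2
    rw [h] at hz
    refine ⟨⟨{x.1}, hN.mem hz (by simp [ZFSet.pair])⟩,
      ⟨{x.1, y.1}, hN.mem hz (by simp [ZFSet.pair])⟩, ?_, ?_, ?_⟩
    · intro w
      simp [Subtype.ext_iff]
    · intro w
      simp [Subtype.ext_iff]
    · intro w
      simp [Subtype.ext_iff, h, ZFSet.pair]

theorem pairMemIn_iff (hN : TransClass N) {x y f : N} :
    PairMemIn N x y f ↔ ZFSet.pair x.1 y.1 ∈ f.1 := by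
  constructor
  · rintro ⟨z, hz, hf⟩
    exact hN.pairIn_iff.1 hz ▸ hf
  · intro h
    exact ⟨⟨_, hN.mem f.2 h⟩, hN.pairIn_iff.2 rfl, h⟩

end TransClass

/-! ### Sets in a transitive model of ZFC -/

namespace IsTransitiveModelZFC

variable {V : Set ZFSet.{u}}

theorem unordered_pair_mem (hV : IsTransitiveModelZFC V) {x y : ZFSet.{u}} (hx : x ∈ V)
    (hy : y ∈ V) : ({x, y} : ZFSet.{u}) ∈ V := by
  obtain ⟨z, hz⟩ := hV.pairing ⟨x, hx⟩ ⟨y, hy⟩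
  convert z.2
  ext w
  rw [ZFSet.mem_pair]
  refine ⟨?_, fun h => ?_⟩
  · rintro (rfl | rfl)
    · exact (hz ⟨w, hx⟩).2 (.inl rfl)
    · exact (hz ⟨w, hy⟩).2 (.inr rfl)
  · exact ((hz ⟨w, hV.trans.mem z.2 h⟩).1 h).imp (congrArg Subtype.val) (congrArg Subtype.val)

theorem singleton_mem (hV : IsTransitiveModelZFC V) {x : ZFSet.{u}} (hx : x ∈ V) :
    ({x} : ZFSet.{u}) ∈ V := by
  rw [← ZFSet.pair_eq_singleton]
  exact hV.unordered_pair_mem hx hx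

theorem pair_mem (hV : IsTransitiveModelZFC V) {x y : ZFSet.{u}} (hx : x ∈ V) (hy : y ∈ V) :
    ZFSet.pair x y ∈ V :=
  hV.unordered_pair_mem (hV.singleton_mem hx) (hV.unordered_pair_mem hx hy)

theorem insert_mem (hV : IsTransitiveModelZFC V) {x y : ZFSet.{u}} (hx : x ∈ V) (hy : y ∈ V) :
    insert x y ∈ V := by
  obtain ⟨z, hz⟩ := hV.union ⟨_, hV.unordered_pair_mem (hV.singleton_mem hx) hy⟩
  convert z.2
  ext w
  have key : w ∈ insert x y ↔ ∃ a : V, w ∈ a.1 ∧ a.1 ∈ ({{x}, y} : ZFSet.{u}) := by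
    rw [ZFSet.mem_insert_iff]
    constructor
    · rintro (rfl | h)
      · exact ⟨⟨{w}, hV.singleton_mem hx⟩, by simp⟩
      · exact ⟨⟨y, hy⟩, h, by simp⟩
    · rintro ⟨a, hwa, ha⟩
      rcases ZFSet.mem_pair.1 ha with h | h
      · rw [h, ZFSet.mem_singleton] at hwa
        exact .inl hwa
      · exact .inr (h ▸ hwa)
  refine ⟨fun h => ?_, fun h => ?_⟩
  · obtain ⟨a, ha⟩ := key.1 h
    exact (hz ⟨w, hV.trans.mem a.2 ha.1⟩).2 ⟨a, ha⟩
  · exact key.2 ((hz ⟨w, hV.trans.mem z.2 h⟩).1 h)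

/-- Replacement for a relation given by a uniformly definable predicate and parameters `c`, with
the image described among all sets. -/
theorem exists_image (hV : IsTransitiveModelZFC V) {n : ℕ}
    {P : ∀ N : Set ZFSet.{u}, (Fin (n + 2) → N) → Prop} (hP : UnifDef (n + 2) P) (c : Fin n → V)
    {R : ZFSet.{u} → ZFSet.{u} → Prop}
    (hR : ∀ x y : V, P V (Matrix.vecCons x (Matrix.vecCons y c)) ↔ R x.1 y.1)
    (huniq : ∀ x ∈ V, ∀ y y', R x y → R x y' → y = y') {a : ZFSet.{u}} (ha : a ∈ V) :
    ∃ b ∈ V, ∀ y, y ∈ b ↔ y ∈ V ∧ ∃ x ∈ a, R x y := by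
  obtain ⟨b, hb⟩ := hV.replacement _ (hP.definable₂ c)
    (fun x y y' h h' => Subtype.ext (huniq x.1 x.2 _ _ ((hR x y).1 h) ((hR x y').1 h'))) ⟨a, ha⟩
  refine ⟨b.1, b.2, fun y => ⟨fun h => ?_, ?_⟩⟩
  · have hy := hV.trans.mem b.2 h
    obtain ⟨x, hx, hxy⟩ := (hb ⟨y, hy⟩).1 h
    exact ⟨hy, x.1, hx, (hR x ⟨y, hy⟩).1 hxy⟩
  · rintro ⟨hy, x, hx, hxy⟩
    exact (hb ⟨y, hy⟩).2 ⟨⟨x, hV.trans.mem ha hx⟩, hx, (hR ⟨x, _⟩ ⟨y, hy⟩).2 hxy⟩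

theorem exists_const_fun (hV : IsTransitiveModelZFC V) {d c : ZFSet.{u}} (hd : d ∈ V)
    (hc : c ∈ d) : ∃ f ∈ V, ZFSet.IsFunc d d f ∧ ∀ x ∈ d, ZFSet.pair x c ∈ f := by
  have hcV := hV.trans.mem hd hc
  obtain ⟨f, hfV, hf⟩ := hV.exists_image (n := 1)
    (P := fun N v => PairIn N (v 0) (v 2) (v 1)) (.pairIn _ _ _) ![⟨c, hcV⟩]
    (R := fun x y => y = ZFSet.pair x c) (fun x y => hV.trans.pairIn_iff)
    (fun x _ y y' h h' => h.trans h'.symm) hd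
  have hmem : ∀ x ∈ d, ZFSet.pair x c ∈ f := fun x hx =>
    (hf _).2 ⟨hV.pair_mem (hV.trans.mem hd hx) hcV, x, hx, rfl⟩
  refine ⟨f, hfV, ⟨fun z hz => ?_, fun x hx => ⟨c, hmem x hx, fun y hy => ?_⟩⟩, hmem⟩
  · obtain ⟨-, x, hx, rfl⟩ := (hf z).1 hz
    exact ZFSet.pair_mem_prod.2 ⟨hx, hc⟩
  · obtain ⟨-, x', -, h⟩ := (hf _).1 hy
    exact (ZFSet.pair_inj.1 h).2

/-- Every function `g : δ → δ` in the model lies below some `h : δ → δ` in the model with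
`ξ < h(ξ)`, provided that `δ` is a limit: take `h(ξ) = max(g(ξ), ξ + 1)`. -/
theorem exists_dominating_progressive (hV : IsTransitiveModelZFC V) {δ : Ordinal.{u}}
    (hδ : δ.toZFSet ∈ V) (hlim : ∀ a < δ, a + 1 < δ) {g : ZFSet.{u}} (hg : g ∈ V)
    (hgf : ZFSet.IsFunc δ.toZFSet δ.toZFSet g) :
    ∃ h ∈ V, ZFSet.IsFunc δ.toZFSet δ.toZFSet h ∧
      ∀ x y z, ZFSet.pair x y ∈ g → ZFSet.pair x z ∈ h → y ⊆ z ∧ x ∈ z := by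
  have hfun : ∀ {x y y'}, ZFSet.pair x y ∈ g → ZFSet.pair x y' ∈ g → y = y' := fun h h' =>
    (hgf.2 _ (ZFSet.pair_mem_prod.1 (hgf.1 h)).1).unique h h'
  obtain ⟨h, hhV, hh⟩ := hV.exists_image (n := 1)
    (P := fun N v => ∃ y z : N, PairMemIn N (v 0) y (v 2) ∧ PairIn N (v 0) z (v 1) ∧
      ∀ w : N, w.1 ∈ z.1 ↔ w.1 ∈ y.1 ∨ w.1 ∈ (v 0).1 ∨ w = v 0)
    (.ex <| .ex <| .and (.pairMemIn _ _ _) <| .and (.pairIn _ _ _) <| .all <|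
      .iff (.mem _ _) <| .or (.mem _ _) <| .or (.mem _ _) (.eq _ _)) ![⟨g, hg⟩]
    (R := fun x u => ∃ y z, z ∈ V ∧ ZFSet.pair x y ∈ g ∧ u = ZFSet.pair x z ∧
      ∀ w, w ∈ z ↔ w ∈ y ∨ w ∈ x ∨ w = x)
    (fun x u => by
      constructor
      · rintro ⟨y, z, h1, h2, h3⟩
        refine ⟨y.1, z.1, z.2, hV.trans.pairMemIn_iff.1 h1, hV.trans.pairIn_iff.1 h2, fun w =>
          ⟨fun h => ?_, fun h => ?_⟩⟩
        · exact ((h3 ⟨w, hV.trans.mem z.2 h⟩).1 h).imp_right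
            (Or.imp_right (congrArg Subtype.val))
        · have hw : w ∈ V := by
            rcases h with h | h | h
            · exact hV.trans.mem y.2 h
            · exact hV.trans.mem x.2 h
            · exact h ▸ x.2
          exact (h3 ⟨w, hw⟩).2 (h.imp_right (Or.imp_right Subtype.ext))
      · rintro ⟨y, z, hz, h1, h2, h3⟩
        refine ⟨⟨y, (hV.trans.of_pair_mem_mem hg h1).2⟩, ⟨z, hz⟩, hV.trans.pairMemIn_iff.2 h1,
          hV.trans.pairIn_iff.2 h2, fun w => ?_⟩
        rw [Subtype.ext_iff]
        exact h3 w.1)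
    (by
      rintro x - u u' ⟨y, z, -, h1, rfl, h2⟩ ⟨y', z', -, h1', rfl, h2'⟩
      obtain rfl := hfun h1 h1'
      congr 1
      ext w
      rw [h2, h2'])
    hδ
  have hex : ∀ x ∈ δ.toZFSet, ∃ z ∈ δ.toZFSet, ZFSet.pair x z ∈ h := by
    intro x hx
    obtain ⟨y, hy, -⟩ := hgf.2 x hx
    have hyδ := (ZFSet.pair_mem_prod.1 (hgf.1 hy)).2
    obtain ⟨a, ha, rfl⟩ := Ordinal.mem_toZFSet_iff.1 hx
    obtain ⟨c, hc, rfl⟩ := Ordinal.mem_toZFSet_iff.1 hyδ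
    have hz : (max c (a + 1)).toZFSet ∈ δ.toZFSet :=
      Ordinal.toZFSet_mem_toZFSet_iff.2 (max_lt hc (hlim a ha))
    refine ⟨_, hz, (hh _).2 ⟨hV.pair_mem (hV.trans.mem hδ hx) (hV.trans.mem hδ hz), _, hx, _, _,
      hV.trans.mem hδ hz, hy, rfl, fun w => ?_⟩⟩
    have hsucc : w ∈ a.toZFSet ∨ w = a.toZFSet ↔ w ∈ (a + 1).toZFSet := by
      rw [Ordinal.toZFSet_add_one, ZFSet.mem_insert_iff, or_comm]
    rw [hsucc]
    rcases le_total c (a + 1) with hle | hle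
    · rw [max_eq_right hle]
      exact ⟨Or.inr, fun h => h.elim (fun h => Ordinal.toZFSet_subset_toZFSet_iff.2 hle h) id⟩
    · rw [max_eq_left hle]
      exact ⟨Or.inl, fun h => h.elim id fun h => Ordinal.toZFSet_subset_toZFSet_iff.2 hle h⟩
  have hmem : ∀ {x z}, ZFSet.pair x z ∈ h → x ∈ δ.toZFSet ∧ ∃ y, ZFSet.pair x y ∈ g ∧
      ∀ w, w ∈ z ↔ w ∈ y ∨ w ∈ x ∨ w = x := by
    intro x z hxz
    obtain ⟨-, x', hx', y, z', -, h1, h2, h3⟩ := (hh _).1 hxz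
    obtain ⟨rfl, rfl⟩ := ZFSet.pair_inj.1 h2
    exact ⟨hx', y, h1, h3⟩
  have hhfun : ∀ {x z z'}, ZFSet.pair x z ∈ h → ZFSet.pair x z' ∈ h → z = z' := by
    intro x z z' h1 h2
    obtain ⟨-, y, hy, hz⟩ := hmem h1
    obtain ⟨-, y', hy', hz'⟩ := hmem h2
    obtain rfl := hfun hy hy'
    ext w
    rw [hz, hz']
  refine ⟨h, hhV, ⟨fun u hu => ?_, fun x hx => ?_⟩, fun x y z hy hz => ?_⟩
  · obtain ⟨-, x, hx, y, z, -, -, rfl, -⟩ := (hh u).1 hu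
    obtain ⟨z', hz', hz''⟩ := hex x hx
    obtain rfl := hhfun hu hz''
    exact ZFSet.pair_mem_prod.2 ⟨hx, hz'⟩
  · obtain ⟨z, -, hz⟩ := hex x hx
    exact ⟨z, hz, fun z' hz' => hhfun hz' hz⟩
  · obtain ⟨-, y', hy', hz'⟩ := hmem hz
    obtain rfl := hfun hy hy'
    exact ⟨fun w hw => (hz' w).2 (.inl hw), (hz' x).2 (.inr (.inr rfl))⟩

end IsTransitiveModelZFC

/-! ### Check names -/

/-- The check name of `x` which uses only the condition `p`: `{(y̌, p) | y ∈ x}`.  No largest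
condition is available, so a condition from the filter is used instead. -/
noncomputable def check (p x : ZFSet.{u}) : ZFSet.{u} :=
  ZFSet.range fun y : ↥x => ZFSet.pair (check p y.1) p
termination_by x.rank
decreasing_by exact ZFSet.rank_lt_of_mem y.2

theorem mem_check {p x z : ZFSet.{u}} : z ∈ check p x ↔ ∃ y ∈ x, z = ZFSet.pair (check p y) p := by
  rw [check, ZFSet.mem_range]
  constructor
  · rintro ⟨⟨y, hy⟩, rfl⟩
    exact ⟨y, hy, rfl⟩
  · rintro ⟨y, hy, rfl⟩
    exact ⟨⟨y, hy⟩, rfl⟩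

theorem isName_check {P p : ZFSet.{u}} (hp : p ∈ P) (x : ZFSet.{u}) : IsName P (check p x) := by
  induction x using ZFSet.inductionOn with
  | h x ih =>
    refine ⟨_, fun z hz => ?_, fun σ q hσ => ?_⟩
    · obtain ⟨y, -, rfl⟩ := mem_check.1 hz
      exact ⟨_, p, hp, rfl⟩
    · obtain ⟨y, hy, h⟩ := mem_check.1 hσ
      rw [(ZFSet.pair_inj.1 h).1]
      exact ih y hy

theorem val_check {G p : ZFSet.{u}} (hp : p ∈ G) (x : ZFSet.{u}) : val G (check p x) = x := by
  induction x using ZFSet.inductionOn with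
  | h x ih =>
    ext z
    rw [mem_val]
    constructor
    · rintro ⟨σ, q, -, hσ, rfl⟩
      obtain ⟨y, hy, h⟩ := mem_check.1 hσ
      rw [(ZFSet.pair_inj.1 h).1, ih y hy]
      exact hy
    · intro hz
      exact ⟨check p z, p, hp, mem_check.2 ⟨z, hz, rfl⟩, (ih z hz).symm⟩

/-- `h` is a set of pairs `(a, b)`, closed under passing to the elements of `a`, which satisfies
the recursion for `a ↦ check p a`.  The recursion is a local, first-order condition on `h`, so that
the function `check p` is definable over a model of ZFC. -/
def IsCheckApprox (p h : ZFSet.{u}) : Prop :=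
  ∀ a b, ZFSet.pair a b ∈ h → (∀ c ∈ a, ∃ d, ZFSet.pair c d ∈ h) ∧
    ∀ w, w ∈ b ↔ ∃ c ∈ a, ∃ d, ZFSet.pair c d ∈ h ∧ w = ZFSet.pair d p

theorem IsCheckApprox.eq_check {p h : ZFSet.{u}} (hh : IsCheckApprox p h) {a b : ZFSet.{u}}
    (hab : ZFSet.pair a b ∈ h) : b = check p a := by
  induction a using ZFSet.inductionOn generalizing b with
  | h a ih =>
    obtain ⟨h1, h2⟩ := hh a b hab
    ext w
    rw [h2, mem_check]
    constructor
    · rintro ⟨c, hc, d, hcd, rfl⟩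
      exact ⟨c, hc, by rw [ih c hc hcd]⟩
    · rintro ⟨c, hc, rfl⟩
      obtain ⟨d, hd⟩ := h1 c hc
      exact ⟨c, hc, d, hd, by rw [ih c hc hd]⟩

theorem isCheckApprox_of_eq_check {p h : ZFSet.{u}}
    (hh : ∀ a b, ZFSet.pair a b ∈ h → b = check p a ∧ ∀ c ∈ a, ∃ d, ZFSet.pair c d ∈ h) :
    IsCheckApprox p h := by
  intro a b hab
  obtain ⟨rfl, h1⟩ := hh a b hab
  refine ⟨h1, fun w => ?_⟩
  rw [mem_check]
  constructor
  · rintro ⟨c, hc, rfl⟩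
    obtain ⟨d, hd⟩ := h1 c hc
    exact ⟨c, hc, d, hd, by rw [(hh c d hd).1]⟩
  · rintro ⟨c, hc, d, hd, rfl⟩
    exact ⟨c, hc, by rw [(hh c d hd).1]⟩

/-- `N ⊨ "h is an approximation to the function check p"`. -/
def IsCheckApproxIn (N : Set ZFSet.{u}) (p h : N) : Prop :=
  ∀ a b : N, PairMemIn N a b h → (∀ c : N, c.1 ∈ a.1 → ∃ d : N, PairMemIn N c d h) ∧
    ∀ w : N, w.1 ∈ b.1 ↔ ∃ c : N, c.1 ∈ a.1 ∧ ∃ d : N, PairMemIn N c d h ∧ PairIn N d p w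

theorem UnifDef.isCheckApproxIn {n : ℕ} (i j : Fin n) :
    UnifDef.{u} n fun N v => IsCheckApproxIn N (v i) (v j) :=
  .all <| .all <| .imp (.pairMemIn _ _ _) <|
    .and (.all <| .imp (.mem _ _) <| .ex <| .pairMemIn _ _ _) <|
    .all <| .iff (.mem _ _) <| .ex <| .and (.mem _ _) <| .ex <|
      .and (.pairMemIn _ _ _) (.pairIn _ _ _)

namespace IsTransitiveModelZFC

variable {V : Set ZFSet.{u}}

theorem isCheckApproxIn_iff (hV : IsTransitiveModelZFC V) {p h : V} :
    IsCheckApproxIn V p h ↔ IsCheckApprox p.1 h.1 := by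
  have hT := hV.trans
  simp only [IsCheckApproxIn, hT.pairMemIn_iff, hT.pairIn_iff]
  constructor
  · intro H a b hab
    have hm := hT.of_pair_mem_mem h.2 hab
    obtain ⟨h1, h2⟩ := H ⟨a, hm.1⟩ ⟨b, hm.2⟩ hab
    refine ⟨fun c hc => ?_, fun w => ⟨fun hw => ?_, ?_⟩⟩
    · obtain ⟨d, hd⟩ := h1 ⟨c, hT.mem hm.1 hc⟩ hc
      exact ⟨d.1, hd⟩
    · obtain ⟨c, hc, d, hd, hw⟩ := (h2 ⟨w, hT.mem hm.2 hw⟩).1 hw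
      exact ⟨c.1, hc, d.1, hd, hw⟩
    · rintro ⟨c, hc, d, hd, rfl⟩
      have hm' := hT.of_pair_mem_mem h.2 hd
      exact (h2 ⟨_, hV.pair_mem hm'.2 p.2⟩).2 ⟨⟨c, hm'.1⟩, hc, ⟨d, hm'.2⟩, hd, rfl⟩
  · intro H a b hab
    obtain ⟨h1, h2⟩ := H a.1 b.1 hab
    refine ⟨fun c hc => ?_, fun w => (h2 w.1).trans ⟨?_, ?_⟩⟩
    · obtain ⟨d, hd⟩ := h1 c.1 hc
      exact ⟨⟨d, (hT.of_pair_mem_mem h.2 hd).2⟩, hd⟩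
    · rintro ⟨c, hc, d, hd, hw⟩
      have hm' := hT.of_pair_mem_mem h.2 hd
      exact ⟨⟨c, hm'.1⟩, hc, ⟨d, hm'.2⟩, hd, hw⟩
    · rintro ⟨c, hc, d, hd, hw⟩
      exact ⟨c.1, hc, d.1, hd, hw⟩

/-- One step of the recursion: if `check p` is approximated in `V` at all elements of `x`, then it
is so on all of `x` simultaneously, and `check p x ∈ V`. -/
theorem check_step (hV : IsTransitiveModelZFC V) {p t x : ZFSet.{u}} (hp : p ∈ V) (ht : t ∈ V)
    (htt : t.IsTransitive) (hx : x ∈ V) (hxt : x ⊆ t)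
    (IH : ∀ c ∈ x, ∃ h ∈ V, IsCheckApprox p h ∧ ∃ d, ZFSet.pair c d ∈ h) :
    check p x ∈ V ∧ ∃ h ∈ V, IsCheckApprox p h ∧ ZFSet.pair x (check p x) ∈ h := by
  have hT := hV.trans
  -- The union of all approximations in `V`, restricted to `t`.
  obtain ⟨h, hhV, hh⟩ := hV.exists_image (n := 1)
    (P := fun N v => ∃ k : N, IsCheckApproxIn N (v 2) k ∧
      ∃ d : N, PairMemIn N (v 0) d k ∧ PairIn N (v 0) d (v 1))
    (.ex <| .and (.isCheckApproxIn _ _) <| .ex <| .and (.pairMemIn _ _ _) (.pairIn _ _ _))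
    ![⟨p, hp⟩]
    (R := fun c z => ∃ k ∈ V, IsCheckApprox p k ∧ ∃ d, ZFSet.pair c d ∈ k ∧ z = ZFSet.pair c d)
    (fun c z => by
      constructor
      · rintro ⟨k, hk, d, h1, h2⟩
        exact ⟨k.1, k.2, hV.isCheckApproxIn_iff.1 hk, d.1, hT.pairMemIn_iff.1 h1,
          hT.pairIn_iff.1 h2⟩
      · rintro ⟨k, hkV, hk, d, h1, h2⟩
        exact ⟨⟨k, hkV⟩, hV.isCheckApproxIn_iff.2 hk, ⟨d, (hT.of_pair_mem_mem hkV h1).2⟩,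
          hT.pairMemIn_iff.2 h1, hT.pairIn_iff.2 h2⟩)
    (by
      rintro c - z z' ⟨k, -, hk, d, h1, rfl⟩ ⟨k', -, hk', d', h1', rfl⟩
      rw [hk.eq_check h1, hk'.eq_check h1'])
    ht
  have hmem : ∀ {c d}, ZFSet.pair c d ∈ h ↔
      c ∈ t ∧ ∃ k ∈ V, IsCheckApprox p k ∧ ZFSet.pair c d ∈ k := by
    intro c d
    rw [hh]
    constructor
    · rintro ⟨-, c', hc', k, hkV, hk, d', h1, h2⟩
      obtain ⟨rfl, rfl⟩ := ZFSet.pair_inj.1 h2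
      exact ⟨hc', k, hkV, hk, h1⟩
    · rintro ⟨hc, k, hkV, hk, h1⟩
      exact ⟨hT.mem hkV h1, c, hc, k, hkV, hk, d, h1, rfl⟩
  have heq : ∀ {c d}, ZFSet.pair c d ∈ h → d = check p c := by
    intro c d hcd
    obtain ⟨-, k, -, hk, h1⟩ := hmem.1 hcd
    exact hk.eq_check h1
  have hdom : ∀ c ∈ x, ∃ d, ZFSet.pair c d ∈ h := by
    intro c hc
    obtain ⟨k, hkV, hk, d, hd⟩ := IH c hc
    exact ⟨d, hmem.2 ⟨hxt hc, k, hkV, hk, hd⟩⟩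
  have hcheck : check p x ∈ V := by
    obtain ⟨b, hbV, hb⟩ := hV.exists_image (n := 2)
      (P := fun N v => ∃ d : N, PairMemIn N (v 0) d (v 2) ∧ PairIn N d (v 3) (v 1))
      (.ex <| .and (.pairMemIn _ _ _) (.pairIn _ _ _)) ![⟨h, hhV⟩, ⟨p, hp⟩]
      (R := fun c w => ∃ d, ZFSet.pair c d ∈ h ∧ w = ZFSet.pair d p)
      (fun c w => by
        constructor
        · rintro ⟨d, h1, h2⟩
          exact ⟨d.1, hT.pairMemIn_iff.1 h1, hT.pairIn_iff.1 h2⟩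
        · rintro ⟨d, h1, h2⟩
          exact ⟨⟨d, (hT.of_pair_mem_mem hhV h1).2⟩, hT.pairMemIn_iff.2 h1,
            hT.pairIn_iff.2 h2⟩)
      (by
        rintro c - w w' ⟨d, h1, rfl⟩ ⟨d', h1', rfl⟩
        rw [heq h1, heq h1'])
      hx
    convert hbV
    ext w
    rw [hb, mem_check]
    constructor
    · rintro ⟨c, hc, rfl⟩
      obtain ⟨d, hd⟩ := hdom c hc
      have hd' := heq hd
      subst hd'
      exact ⟨hV.pair_mem (hT.of_pair_mem_mem hhV hd).2 hp, c, hc, _, hd, rfl⟩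
    · rintro ⟨-, c, hc, d, hd, rfl⟩
      exact ⟨c, hc, by rw [heq hd]⟩
  refine ⟨hcheck, insert (ZFSet.pair x (check p x)) h,
    hV.insert_mem (hV.pair_mem hx hcheck) hhV, isCheckApprox_of_eq_check fun a b hab => ?_,
    ZFSet.mem_insert_iff.2 (.inl rfl)⟩
  rcases ZFSet.mem_insert_iff.1 hab with hab | hab
  · obtain ⟨rfl, rfl⟩ := ZFSet.pair_inj.1 hab
    exact ⟨rfl, fun c hc => (hdom c hc).imp fun d hd => ZFSet.mem_insert_iff.2 (.inr hd)⟩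
  · refine ⟨heq hab, fun c hc => ?_⟩
    obtain ⟨hat, k, hkV, hk, h1⟩ := hmem.1 hab
    obtain ⟨d, hd⟩ := (hk a b h1).1 c hc
    exact ⟨d, ZFSet.mem_insert_iff.2 (.inr (hmem.2 ⟨htt.mem_trans hc hat, k, hkV, hk, hd⟩))⟩

theorem check_mem (hV : IsTransitiveModelZFC V) {p t : ZFSet.{u}} (hp : p ∈ V) (ht : t ∈ V)
    (htt : t.IsTransitive) : check p t ∈ V := by
  have key : ∀ x, x ∈ t → ∃ h ∈ V, IsCheckApprox p h ∧ ∃ d, ZFSet.pair x d ∈ h := by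
    intro x
    induction x using ZFSet.inductionOn with
    | h x ih =>
      intro hx
      obtain ⟨-, h, hhV, hh, hxh⟩ := hV.check_step hp ht htt (hV.trans.mem ht hx) (htt x hx)
        fun c hc => ih c hc (htt.mem_trans hc hx)
      exact ⟨h, hhV, hh, _, hxh⟩
  exact (hV.check_step hp ht htt ht (fun _ h => h) key).1

end IsTransitiveModelZFC

theorem transClass_genericExt {V : Set ZFSet.{u}} (hV : TransClass V) (ℙ : ForcingNotion.{u})
    (G : ZFSet.{u}) : TransClass (genericExt V ℙ G) := by
  rintro x ⟨τ, hτV, hτ, rfl⟩ y hy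
  obtain ⟨σ, p, -, hσ, rfl⟩ := mem_val.1 hy
  cases hτ with
  | mk _ _ hname => exact ⟨σ, (hV.of_pair_mem_mem hτV hσ).1, hname σ p hσ, rfl⟩

theorem mem_genericExt_of_isTransitive {V : Set ZFSet.{u}} (hV : IsTransitiveModelZFC V)
    {ℙ : ForcingNotion.{u}} (hℙ : ℙ.Mem V) {G : ZFSet.{u}} (hG : IsGenericFilter V ℙ G)
    {t : ZFSet.{u}} (ht : t ∈ V) (htt : t.IsTransitive) : t ∈ genericExt V ℙ G := by
  obtain ⟨p, hp⟩ := hG.nonempty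
  exact ⟨check p t, hV.check_mem (hV.trans.mem hℙ.1 (hG.subset hp)) ht htt,
    isName_check (hG.subset hp) t, (val_check hp t).symm⟩

/-! ### Elementary embeddings between transitive classes -/

namespace ClassEmbedding

variable {N : Set ZFSet.{u}} (e : ClassEmbedding N)

namespace Maps

variable {e} {x y f x' y' f' d d' : ZFSet.{u}}

theorem mem_source (h : e.Maps x x') : x ∈ N := h.1

theorem unique (h : e.Maps x x') (h' : e.Maps x y') : x' = y' := by
  obtain ⟨hx, rfl⟩ := h
  obtain ⟨-, rfl⟩ := h'
  rfl

theorem mem_iff (hx : e.Maps x x') (hy : e.Maps y y') : x' ∈ y' ↔ x ∈ y := by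
  obtain ⟨hx, rfl⟩ := hx
  obtain ⟨hy, rfl⟩ := hy
  exact (UnifDef.mem 0 1).elementary e.j ![⟨x, hx⟩, ⟨y, hy⟩]

theorem empty (h : e.Maps ∅ x') : x' = ∅ := by
  obtain ⟨hx, rfl⟩ := h
  have key := ((UnifDef.all (n := 1) (P := fun _ v z => ¬ z.1 ∈ (v 0).1)
    (.not (.mem _ _))).elementary e.j ![⟨∅, hx⟩]).2 fun z => ZFSet.notMem_empty _
  exact (ZFSet.eq_empty _).2 fun z hz => key ⟨z, e.trans.mem (e.j _).2 hz⟩ hz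

theorem isTransitive (h : e.Maps x x') (hx : x.IsTransitive) :
    x'.IsTransitive := by
  obtain ⟨hxN, rfl⟩ := h
  have key := ((UnifDef.all (n := 1)
    (P := fun N v y => ∀ z : N, z.1 ∈ y.1 → y.1 ∈ (v 0).1 → z.1 ∈ (v 0).1)
    (.all <| .imp (.mem _ _) <| .imp (.mem _ _) (.mem _ _))).elementary e.j ![⟨x, hxN⟩]).2
    fun y z hzy hy => hx.mem_trans hzy hy
  refine fun y hy z hz => ?_
  have hyM := e.trans.mem (e.j _).2 hy
  exact key ⟨y, hyM⟩ ⟨z, e.trans.mem hyM hz⟩ hz hy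

theorem pair_mem_iff (hN : TransClass N) (hx : e.Maps x x') (hy : e.Maps y y')
    (hf : e.Maps f f') : ZFSet.pair x' y' ∈ f' ↔ ZFSet.pair x y ∈ f := by
  obtain ⟨hx, rfl⟩ := hx
  obtain ⟨hy, rfl⟩ := hy
  obtain ⟨hf, rfl⟩ := hf
  have key := (UnifDef.pairMemIn 0 1 2).elementary e.j ![⟨x, hx⟩, ⟨y, hy⟩, ⟨f, hf⟩]
  exact e.trans.pairMemIn_iff.symm.trans (key.trans hN.pairMemIn_iff)

/-- The embedding preserves `∀ x ∈ d, ∃ y, (x, y) ∈ f`. -/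
theorem exists_pair_mem (hN : TransClass N) (hd : e.Maps d d') (hf : e.Maps f f')
    (h : ∀ x ∈ d, ∃ y, ZFSet.pair x y ∈ f) : ∀ x ∈ d', ∃ y, ZFSet.pair x y ∈ f' := by
  obtain ⟨hd, rfl⟩ := hd
  obtain ⟨hf, rfl⟩ := hf
  have key := ((UnifDef.all (n := 2)
    (P := fun N v x => x.1 ∈ (v 0).1 → ∃ y : N, PairMemIn N x y (v 1))
    (.imp (.mem _ _) <| .ex <| .pairMemIn _ _ _)).elementary e.j ![⟨d, hd⟩, ⟨f, hf⟩]).2 (by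
      intro x hx
      obtain ⟨y, hy⟩ := h x.1 hx
      exact ⟨⟨y, (hN.of_pair_mem_mem hf hy).2⟩, hN.pairMemIn_iff.2 hy⟩)
  intro x hx
  obtain ⟨y, hy⟩ := key ⟨x, e.trans.mem (e.j _).2 hx⟩ hx
  exact ⟨y.1, e.trans.pairMemIn_iff.1 hy⟩

/-- The embedding preserves surjectivity: `∀ y ∈ d, ∃ x ∈ a, (x, y) ∈ f`. -/
theorem exists_preimage (hN : TransClass N) {a a' : ZFSet.{u}} (ha : e.Maps a a')
    (hd : e.Maps d d') (hf : e.Maps f f') (h : ∀ y ∈ d, ∃ x ∈ a, ZFSet.pair x y ∈ f) :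
    ∀ y ∈ d', ∃ x ∈ a', ZFSet.pair x y ∈ f' := by
  obtain ⟨ha, rfl⟩ := ha
  obtain ⟨hd, rfl⟩ := hd
  obtain ⟨hf, rfl⟩ := hf
  have key := ((UnifDef.all (n := 3)
    (P := fun N v y => y.1 ∈ (v 0).1 → ∃ x : N, x.1 ∈ (v 2).1 ∧ PairMemIn N x y (v 1))
    (.imp (.mem _ _) <| .ex <| .and (.mem _ _) <| .pairMemIn _ _ _)).elementary e.j
    ![⟨d, hd⟩, ⟨f, hf⟩, ⟨a, ha⟩]).2 (by
      intro y hy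
      obtain ⟨x, hx, hxy⟩ := h y.1 hy
      exact ⟨⟨x, hN.mem ha hx⟩, hx, hN.pairMemIn_iff.2 hxy⟩)
  intro y hy
  obtain ⟨x, hx, hxy⟩ := key ⟨y, e.trans.mem (e.j _).2 hy⟩ hy
  exact ⟨x.1, hx, e.trans.pairMemIn_iff.1 hxy⟩

/-- The embedding preserves single-valuedness. -/
theorem pair_unique (hN : TransClass N) (hf : e.Maps f f')
    (h : ∀ x y z, ZFSet.pair x y ∈ f → ZFSet.pair x z ∈ f → y = z) :
    ∀ x y z, ZFSet.pair x y ∈ f' → ZFSet.pair x z ∈ f' → y = z := by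
  obtain ⟨hf, rfl⟩ := hf
  have key := ((UnifDef.all (n := 1)
    (P := fun N v x => ∀ y z : N, PairMemIn N x y (v 0) → PairMemIn N x z (v 0) → y = z)
    (.all <| .all <| .imp (.pairMemIn _ _ _) <| .imp (.pairMemIn _ _ _) (.eq _ _))).elementary
    e.j ![⟨f, hf⟩]).2 fun x y z hy hz =>
      Subtype.ext (h _ _ _ (hN.pairMemIn_iff.1 hy) (hN.pairMemIn_iff.1 hz))
  intro x y z hy hz
  have hy' := e.trans.of_pair_mem_mem (e.j _).2 hy
  have hz' := e.trans.of_pair_mem_mem (e.j _).2 hz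
  exact congrArg Subtype.val (key ⟨x, hy'.1⟩ ⟨y, hy'.2⟩ ⟨z, hz'.2⟩
    (e.trans.pairMemIn_iff.2 hy) (e.trans.pairMemIn_iff.2 hz))

/-- The embedding preserves strict domination of one function by another. -/
theorem dominated (hN : TransClass N) {g g' : ZFSet.{u}} (hf : e.Maps f f') (hg : e.Maps g g')
    (h : ∀ x y z, ZFSet.pair x y ∈ f → ZFSet.pair x z ∈ g → y ∈ z) :
    ∀ x y z, ZFSet.pair x y ∈ f' → ZFSet.pair x z ∈ g' → y ∈ z := by
  obtain ⟨hf, rfl⟩ := hf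
  obtain ⟨hg, rfl⟩ := hg
  have key := ((UnifDef.all (n := 2)
    (P := fun N v x => ∀ y z : N, PairMemIn N x y (v 0) → PairMemIn N x z (v 1) → y.1 ∈ z.1)
    (.all <| .all <| .imp (.pairMemIn _ _ _) <| .imp (.pairMemIn _ _ _) (.mem _ _))).elementary
    e.j ![⟨f, hf⟩, ⟨g, hg⟩]).2 fun x y z hy hz =>
      h _ _ _ (hN.pairMemIn_iff.1 hy) (hN.pairMemIn_iff.1 hz)
  intro x y z hy hz
  have hy' := e.trans.of_pair_mem_mem (e.j _).2 hy
  have hz' := e.trans.of_pair_mem_mem (e.j _).2 hz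
  exact key ⟨x, hy'.1⟩ ⟨y, hy'.2⟩ ⟨z, hz'.2⟩
    (e.trans.pairMemIn_iff.2 hy) (e.trans.pairMemIn_iff.2 hz)

end Maps

variable {e}

theorem Crit.pos {κ : Ordinal.{u}} (h : e.Crit κ) : 0 < κ := by
  rw [pos_iff_ne_zero]
  rintro rfl
  obtain ⟨-, y, hy, hne⟩ := h
  rw [Ordinal.toZFSet_zero] at hy hne
  exact hne hy.empty

/-- A strongness embedding sends no ordinal `η` to an ordinal `ζ ≤ lam` unless `η < κ`, since
`lam < j(κ) ≤ j(η)` for `κ ≤ η`. -/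
theorem IsStrongness.lt_crit {κ lam η ζ : Ordinal.{u}} (h : e.IsStrongness κ lam)
    (hη : e.Maps η.toZFSet ζ.toZFSet) (hζ : ζ ≤ lam) : η < κ := by
  obtain ⟨-, -, ⟨y, hy, hly⟩, -⟩ := h
  by_contra! hle
  have hmem : lam.toZFSet ∈ ζ.toZFSet := by
    rcases hle.eq_or_lt with rfl | hlt
    · rwa [hη.unique hy]
    · have h1 : y ∈ ζ.toZFSet := (hy.mem_iff hη).2 (Ordinal.toZFSet_mem_toZFSet_iff.2 hlt)
      exact (ZFSet.isOrdinal_toZFSet ζ).mem_trans hly h1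
  exact hζ.not_gt (Ordinal.toZFSet_mem_toZFSet_iff.1 hmem)

/-- The critical point itself is not a value of a strongness embedding on ordinals. -/
theorem IsStrongness.not_maps_crit {κ lam η : Ordinal.{u}} (h : e.IsStrongness κ lam) :
    ¬ e.Maps η.toZFSet κ.toZFSet := by
  intro hη
  have hlt := h.lt_crit hη h.1
  exact hlt.ne (Ordinal.toZFSet_injective ((h.2.1.1 η hlt).unique hη))

theorem IsStrongness.crit_mem {κ lam : Ordinal.{u}}
    (h : e.IsStrongness κ lam) {y : ZFSet.{u}} (hy : e.Maps κ.toZFSet y) : κ.toZFSet ∈ y := by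
  obtain ⟨hle, -, ⟨y', hy', hly⟩, -⟩ := h
  obtain rfl := hy.unique hy'
  rcases hle.eq_or_lt with rfl | hlt
  · exact hly
  · exact (hy.isTransitive (ZFSet.isOrdinal_toZFSet κ).isTransitive).mem_trans
      (Ordinal.toZFSet_mem_toZFSet_iff.2 hlt) hly

theorem IsStrongness.crit_mem_of_lt {κ lam δ : Ordinal.{u}}
    (h : e.IsStrongness κ lam) (hκ : κ < δ) {d : ZFSet.{u}} (hd : e.Maps δ.toZFSet d) :
    κ.toZFSet ∈ d := by
  obtain ⟨y, hy, -⟩ := h.2.2.1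
  exact (hd.isTransitive (ZFSet.isOrdinal_toZFSet δ).isTransitive).mem_trans
    (h.crit_mem hy) ((hy.mem_iff hd).2 (Ordinal.toZFSet_mem_toZFSet_iff.2 hκ))

/-- If `j` is `lam`-strong for `h` and `lam` is a limit, then `h` and `j(h)` agree below `lam`. -/
theorem IsStrongnessFor.pair_mem {h H : ZFSet.{u}} {κ lam a c : Ordinal.{u}}
    (hN : TransClass N) (he : e.IsStrongnessFor h κ lam) (hlim : ∀ b < lam, b + 1 < lam)
    (ha : a < lam) (hc : c < lam) (hH : e.Maps h H)
    (hac : ZFSet.pair a.toZFSet c.toZFSet ∈ h) : ZFSet.pair a.toZFSet c.toZFSet ∈ H := by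
  obtain ⟨-, B, hB, hagree⟩ := he
  obtain rfl := hH.unique hB
  refine (hagree _ ⟨hN.mem hH.mem_source hac, ?_⟩).1 hac
  rw [ZFSet.mem_vonNeumann]
  have h2 : ∀ b < lam, Order.succ (Order.succ b) < lam := fun b hb => by
    simpa using hlim _ (hlim b hb)
  simp only [ZFSet.pair, ZFSet.rank_pair, ZFSet.rank_singleton, Ordinal.rank_toZFSet]
  have hs : ∀ b < lam, Order.succ b < lam := fun b hb => by simpa using hlim b hb
  exact max_lt (hs _ (hs _ ha)) (hs _ (max_lt (hs _ ha) (hs _ hc)))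

/-- If `j` is `lam`-strong for a function `h` which maps the limit `lam` to itself, then `h` maps
`κ = crit(j)` to itself: for `a < κ` the pair `(a, h(a))` lies in `j(h)` by agreement, and
`(a, j(h(a)))` lies in `j(h)` by elementarity.  So `j` fixes `h(a) < lam`, hence `h(a) < κ`. -/
theorem IsStrongnessFor.isClosurePoint {h : ZFSet.{u}} {κ lam : Ordinal.{u}}
    (hN : TransClass N) (he : e.IsStrongnessFor h κ lam) (hlim : ∀ b < lam, b + 1 < lam)
    (huniq : ∀ x y z, ZFSet.pair x y ∈ h → ZFSet.pair x z ∈ h → y = z)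
    (hcl : IsClosurePoint h lam) : IsClosurePoint h κ := by
  intro x hx y hxy
  obtain ⟨a, ha, rfl⟩ := Ordinal.mem_toZFSet_iff.1 hx
  have hal : a < lam := ha.trans_le he.1.1
  obtain ⟨c, hc, rfl⟩ := Ordinal.mem_toZFSet_iff.1
    (hcl _ (Ordinal.toZFSet_mem_toZFSet_iff.2 hal) _ hxy)
  obtain ⟨H, hH, -⟩ := he.2
  have h1 := he.pair_mem hN hlim hal hc hH hxy
  have hcN := (hN.of_pair_mem_mem hH.mem_source hxy).2
  have hcj : e.Maps c.toZFSet (e.j ⟨_, hcN⟩).1 := ⟨hcN, rfl⟩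
  have h2 := (Maps.pair_mem_iff hN (he.1.2.1.1 a ha) hcj hH).2 hxy
  rw [← hH.pair_unique hN huniq _ _ _ h1 h2] at hcj
  exact Ordinal.toZFSet_mem_toZFSet_iff.2 (he.1.lt_crit hcj hc.le)

end ClassEmbedding

/-! ### Woodin cardinals in the generic extension -/

theorem isFunc_unique {x y f a b c : ZFSet.{u}} (hf : ZFSet.IsFunc x y f)
    (hb : ZFSet.pair a b ∈ f) (hc : ZFSet.pair a c ∈ f) : b = c :=
  (hf.2 a (ZFSet.pair_mem_prod.1 (hf.1 hb)).1).unique hb hc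

/-- A Woodin cardinal is a limit ordinal: a closure point of the constant function with value `a`
lies strictly between `a` and `δ`. -/
theorem IsWoodinIn.add_one_lt {V : Set ZFSet.{u}} (hV : IsTransitiveModelZFC V) {δ : Ordinal.{u}}
    (hδ : IsWoodinIn V δ) {a : Ordinal.{u}} (ha : a < δ) : a + 1 < δ := by
  obtain ⟨f, hfV, hf, hfa⟩ :=
    hV.exists_const_fun hδ.1.1 (Ordinal.toZFSet_mem_toZFSet_iff.2 ha)
  obtain ⟨κ, hκ, hcl, e, hcrit, -⟩ := hδ.2 f hfV hf
  have h0 := hcrit.pos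
  have h1 := hcl (Ordinal.toZFSet 0) (Ordinal.toZFSet_mem_toZFSet_iff.2 h0) _
    (hfa _ (Ordinal.toZFSet_mem_toZFSet_iff.2 (h0.trans hκ)))
  exact (Order.add_one_le_of_lt (Ordinal.toZFSet_mem_toZFSet_iff.1 h1)).trans_lt hκ

/-- Suppose every function of `V` from `δ` to `δ` has strongness embeddings of `N` as in
`htemplate`.  Then every such `g` is dominated by some `h` for which moreover `κ = crit(j)` is a
closure point and `j(h)(κ) = h(κ) < lam`.  The function `h` is chosen with `ξ < h(ξ)`, which makes
`lam` a limit. -/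
theorem exists_strongness_dominating {V : Set ZFSet.{u}} (hV : IsTransitiveModelZFC V)
    {δ : Ordinal.{u}} (hδ : IsWoodinIn V δ) {N : Set ZFSet.{u}} (hN : TransClass N)
    (htemplate : ∀ f ∈ V, ZFSet.IsFunc δ.toZFSet δ.toZFSet f →
      ∃ κ lam : Ordinal.{u}, κ ≤ lam ∧ lam < δ ∧ IsClosurePoint f lam ∧
        (∃ β < lam, ZFSet.pair κ.toZFSet β.toZFSet ∈ f) ∧
        ∃ e : ClassEmbedding N, e.IsStrongnessFor f κ lam)
    {g : ZFSet.{u}} (hg : g ∈ V) (hgf : ZFSet.IsFunc δ.toZFSet δ.toZFSet g) :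
    ∃ h H : ZFSet.{u}, ZFSet.IsFunc δ.toZFSet δ.toZFSet h ∧
      (∀ x y z, ZFSet.pair x y ∈ g → ZFSet.pair x z ∈ h → y ⊆ z) ∧
      ∃ κ lam β : Ordinal.{u}, κ < δ ∧ β < lam ∧ IsClosurePoint h κ ∧
        ∃ e : ClassEmbedding N, e.IsStrongness κ lam ∧ e.Maps h H ∧
          ZFSet.pair κ.toZFSet β.toZFSet ∈ H := by
  obtain ⟨h, hhV, hh, hdom⟩ :=
    hV.exists_dominating_progressive hδ.1.1 (fun a => hδ.add_one_lt hV) hg hgf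
  obtain ⟨κ, lam, hκl, hlδ, hcl, ⟨β, hβ, hκβ⟩, e, he⟩ := htemplate h hhV hh
  have hlim : ∀ b < lam, b + 1 < lam := by
    intro b hb
    have hbδ := Ordinal.toZFSet_mem_toZFSet_iff.2 (hb.trans hlδ)
    obtain ⟨y, hy, -⟩ := hgf.2 _ hbδ
    obtain ⟨z, hz, -⟩ := hh.2 _ hbδ
    have hzl := hcl _ (Ordinal.toZFSet_mem_toZFSet_iff.2 hb) _ hz
    have hbz := (hdom _ _ _ hy hz).2
    obtain ⟨c, hc, rfl⟩ := Ordinal.mem_toZFSet_iff.1 hzl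
    exact (Order.add_one_le_of_lt (Ordinal.toZFSet_mem_toZFSet_iff.1 hbz)).trans_lt hc
  -- The value `h(κ)` lies above `κ`, so `κ < lam` and agreement below `lam` applies to it.
  have hκ : κ < lam := by
    obtain ⟨y, hy, -⟩ := hgf.2 _ (Ordinal.toZFSet_mem_toZFSet_iff.2 (hκl.trans_lt hlδ))
    exact (Ordinal.toZFSet_mem_toZFSet_iff.1 (hdom _ _ _ hy hκβ).2).trans hβ
  obtain ⟨H, hH, -⟩ := he.2
  exact ⟨h, H, hh, fun x y z hy hz => (hdom x y z hy hz).1, κ, lam, β, hκl.trans_lt hlδ, hβ,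
    he.isClosurePoint hN hlim (fun x y z => isFunc_unique hh) hcl, e, he.1, hH,
    he.pair_mem hN hlim hκ hβ hH hκβ⟩

end WoodinForcing

theorem proposition3p1 (V : Set ZFSet.{u}) (hV : WoodinForcing.IsTransitiveModelZFC V)
    (δ : Ordinal.{u}) (hδ : WoodinForcing.IsWoodinIn V δ)
    (ℙ : WoodinForcing.ForcingNotion.{u}) (hℙ : ℙ.Mem V)
    (hbound : WoodinForcing.IsBounding V ℙ δ)
    (G : ZFSet.{u}) (hG : WoodinForcing.IsGenericFilter V ℙ G)
    (htemplate : ∀ f ∈ V, ZFSet.IsFunc δ.toZFSet δ.toZFSet f →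
      ∃ κ lam : Ordinal.{u}, κ ≤ lam ∧ lam < δ ∧ WoodinForcing.IsClosurePoint f lam ∧
        (∃ β < lam, ZFSet.pair κ.toZFSet β.toZFSet ∈ f) ∧
        ∃ e : WoodinForcing.ClassEmbedding (WoodinForcing.genericExt V ℙ G),
          e.IsStrongnessFor f κ lam) :
    WoodinForcing.IsWoodinIn (WoodinForcing.genericExt V ℙ G) δ := by
  have hN := WoodinForcing.transClass_genericExt hV.trans ℙ G
  have hδN := WoodinForcing.mem_genericExt_of_isTransitive hV hℙ hG hδ.1.1
    (ZFSet.isOrdinal_toZFSet δ).isTransitive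
  refine ⟨⟨hδN, fun α hα b hb hbf hbij => ?_⟩, fun f hf hff => ?_⟩
  · -- A surjection `b : α → δ` is sent to a surjection `j(b) : α → j(δ)`, provided that
    -- `α < κ = crit(j)`, and all values of `j(b)` are in the range of `j`; but `κ ∈ j(δ)` is not.
    have hαδ := Ordinal.toZFSet_mem_toZFSet_iff.2 hα
    obtain ⟨g, hgV, hgf, hgα⟩ := hV.exists_const_fun hδ.1.1 hαδ
    obtain ⟨h, H, hh, hdom, κ, lam, β, hκδ, hβ, hcl, e, he, -, -⟩ :=
      WoodinForcing.exists_strongness_dominating hV hδ hN htemplate hgV hgf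
    have hακ : α < κ := by
      have h0 : Ordinal.toZFSet 0 ∈ κ.toZFSet := Ordinal.toZFSet_mem_toZFSet_iff.2 he.2.1.pos
      have h0δ := Ordinal.toZFSet_mem_toZFSet_iff.2 (he.2.1.pos.trans hκδ)
      obtain ⟨z, hz, -⟩ := hh.2 _ h0δ
      have hzκ := hcl _ h0 _ hz
      have hsub := hdom _ _ _ (hgα _ h0δ) hz
      obtain ⟨c, hc, rfl⟩ := Ordinal.mem_toZFSet_iff.1 hzκ
      exact (Ordinal.toZFSet_subset_toZFSet_iff.1 hsub).trans_lt hc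
    have hjδ : e.Maps δ.toZFSet (e.j ⟨_, hδN⟩).1 := ⟨hδN, rfl⟩
    have hjb : e.Maps b (e.j ⟨_, hb⟩).1 := ⟨hb, rfl⟩
    obtain ⟨x, hx, hxκ⟩ := (he.2.1.1 α hακ).exists_preimage hN hjδ hjb
      (fun y hy => by
        obtain ⟨x, hx, -⟩ := hbij y hy
        exact ⟨x, (ZFSet.pair_mem_prod.1 (hbf.1 hx)).1, hx⟩) _ (he.crit_mem_of_lt hκδ hjδ)
    obtain ⟨ξ, hξ, rfl⟩ := Ordinal.mem_toZFSet_iff.1 hx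
    obtain ⟨y, hy, -⟩ := hbf.2 _ hx
    obtain ⟨η, -, rfl⟩ := Ordinal.mem_toZFSet_iff.1 (ZFSet.pair_mem_prod.1 (hbf.1 hy)).2
    have hηN := (hN.of_pair_mem_mem hb hy).2
    have hη : e.Maps η.toZFSet (e.j ⟨_, hηN⟩).1 := ⟨hηN, rfl⟩
    have hy' := (WoodinForcing.ClassEmbedding.Maps.pair_mem_iff hN
      (he.2.1.1 ξ (hξ.trans hακ)) hη hjb).2 hy
    rw [hjb.pair_unique hN (fun _ _ _ => WoodinForcing.isFunc_unique hbf) _ _ _ hy' hxκ] at hη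
    exact he.not_maps_crit hη
  · obtain ⟨g, hgV, hgf, hfg⟩ := hbound G hG f hf hff
    obtain ⟨h, H, hh, hdom, κ, lam, β, hκδ, hβ, hcl, e, he, hH, hκβ⟩ :=
      WoodinForcing.exists_strongness_dominating hV hδ hN htemplate hgV hgf
    have hfh : ∀ x y z, ZFSet.pair x y ∈ f → ZFSet.pair x z ∈ h → y ∈ z := by
      intro x y z hy hz
      obtain ⟨w, hw, -⟩ := hgf.2 x (ZFSet.pair_mem_prod.1 (hff.1 hy)).1
      exact hdom _ _ _ hw hz (hfg _ _ _ hy hw)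
    refine ⟨κ, hκδ, fun x hx y hxy => ?_, e, he.2.1, ?_⟩
    · obtain ⟨z, hz, -⟩ := hh.2 x (ZFSet.pair_mem_prod.1 (hff.1 hxy)).1
      exact (ZFSet.isOrdinal_toZFSet κ).mem_trans (hfh _ _ _ hxy hz) (hcl x hx z hz)
    · have hjδ : e.Maps δ.toZFSet (e.j ⟨_, hδN⟩).1 := ⟨hδN, rfl⟩
      have hjf : e.Maps f (e.j ⟨_, hf⟩).1 := ⟨hf, rfl⟩
      obtain ⟨y, hy⟩ := hjδ.exists_pair_mem hN hjf (fun x hx => (hff.2 x hx).exists) _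
        (he.crit_mem_of_lt hκδ hjδ)
      -- Elementarity gives `j(f)(κ) < j(h)(κ) = β < lam`.
      obtain ⟨γ, hγ, rfl⟩ := Ordinal.mem_toZFSet_iff.1 (hjf.dominated hN hH hfh _ _ _ hy hκβ)
      exact ⟨_, γ, hjf, hy, fun x hx => he.2.2.2
        ⟨hx.1, ZFSet.vonNeumann_subset_of_le (hγ.trans hβ).le hx.2⟩⟩
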